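/- Let $d\ge 1$ and $n\ge 1$ be integers and let $a>0$ be real. Define $V:\mathbb R^d\to\mathbb R$ by $V(x)=a|x|^{2n}+e^{-1/|x|}$ for $x\neq 0$ and $V(0)=0$, where $|\cdot|$ is the Euclidean norm. Then for every real $h>1$ there is at least one non-constant periodic function $q\in C^2(\mathbb R,\mathbb R^d)$ that satisfies $$\ddot q(t)+\nabla V(q(t))=0\qquad\text{and}\qquad \tfrac12|\dot q(t)|^2+V(q(t))=h\qquad\text{for all } t\in\mathbb R .$$ -/

import Mathlib

/-- The potential `V(x) = a |x|^(2n) + exp (-1/|x|)` for `x ≠ 0`, `V(0) = 0`, on Euclidean `ℝ^d`. -/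
noncomputable def expPotential (d n : ℕ) (a : ℝ) : EuclideanSpace ℝ (Fin d) → ℝ :=
  open Classical in
  fun x => if x = 0 then 0 else a * ‖x‖ ^ (2 * n) + Real.exp (-1 / ‖x‖)

/-- `q` is a classical solution, defined for all times, of `q'' + V'(q) = 0` with
`|q'|² / 2 + V(q) = h`. -/
structure IsEnergySolution {d : ℕ} (V : EuclideanSpace ℝ (Fin d) → ℝ) (h : ℝ)
    (q : ℝ → EuclideanSpace ℝ (Fin d)) : Prop where
  contDiff : ContDiff ℝ 2 q
  differentiableAt : ∀ t, DifferentiableAt ℝ V (q t)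
  newton : ∀ t, deriv (deriv q) t + gradient V (q t) = 0
  energy : ∀ t, (1 / 2 : ℝ) * ‖deriv q t‖ ^ 2 + V (q t) = h

open Real Set Filter Topology MeasureTheory

/-! The potential is radial, so motion along a line, `q = u • e` with `‖e‖ = 1`, reduces to `u'' +
W'(u) = 0` for its even profile `W`, and `u` oscillates between `±A` where `W A = h`. The
substitution `u = A sin φ` removes the turning points: writing `W A - W (A s) = (1 - s²) K s` with
`K > 0` (`exists_pos_factor`; `W' A > 0` gives positivity at `s = ±1`), conservation of energy
follows from `φ' = √(2 K (sin φ)) / A`. This field is positive and `2π`-periodic, so it is solved by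
quadrature, and `φ (t + T) = φ t + 2π` makes `u` periodic. Newton's equation is then recovered from
the energy identity. -/

/-- A positive periodic continuous vector field on the line has a global integral curve through `0`,
which advances by one period of the field in finite time. -/
lemma exists_integralCurve_of_periodic_pos {F : ℝ → ℝ} (hF : Continuous F) (hpos : ∀ x, 0 < F x)
    {c : ℝ} (hc : 0 < c) (hper : Function.Periodic F c) :
    ∃ (φ : ℝ → ℝ) (T : ℝ), 0 < T ∧ φ 0 = 0 ∧ (∀ t, HasDerivAt φ (F (φ t)) t) ∧
      ∀ t, φ (t + T) = φ t + c := by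
  have hG : Continuous fun x => (F x)⁻¹ := hF.inv₀ fun x => (hpos x).ne'
  have hGper : Function.Periodic (fun x => (F x)⁻¹) c := fun x => by simp only [hper x]
  have hint : ∀ a b, IntervalIntegrable (fun x => (F x)⁻¹) volume a b :=
    fun a b => hG.intervalIntegrable a b
  -- Separation of variables: `Φ x` is the time at which the solution reaches `x`, and `φ` is its
  -- inverse.
  set Φ : ℝ → ℝ := fun x => ∫ y in (0 : ℝ)..x, (F y)⁻¹ with hΦ
  have hderiv : ∀ x, HasDerivAt Φ (F x)⁻¹ x := fun x =>
    intervalIntegral.integral_hasDerivAt_right (hint 0 x)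
      (hG.stronglyMeasurableAtFilter _ _) hG.continuousAt
  have hmono : StrictMono Φ := strictMono_of_deriv_pos fun x => by
    rw [(hderiv x).deriv]; exact inv_pos.2 (hpos x)
  have hcont : Continuous Φ := continuous_iff_continuousAt.2 fun x => (hderiv x).continuousAt
  have hΦ0 : Φ 0 = 0 := by simp [hΦ]
  have hT : 0 < Φ c := hΦ0 ▸ hmono hc
  have hadd : ∀ x, Φ (x + c) = Φ x + Φ c := fun x => by
    have h1 := hGper.intervalIntegral_add_eq x 0
    rw [zero_add] at h1
    simp only [hΦ]
    rw [← h1, intervalIntegral.integral_add_adjacent_intervals (hint _ _) (hint _ _)]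
  have hsurj : Function.Surjective Φ := hcont.surjective
    (hGper.tendsto_atTop_intervalIntegral_of_pos hT hc)
    (hGper.tendsto_atBot_intervalIntegral_of_pos hT hc)
  set e := hmono.orderIsoOfSurjective Φ hsurj
  have he : ∀ t, Φ (e.symm t) = t := fun t =>
    hmono.orderIsoOfSurjective_self_symm_apply Φ hsurj t
  refine ⟨e.symm, Φ c, hT, hmono.injective (by rw [he, hΦ0]), fun t => ?_, fun t =>
    hmono.injective (by rw [he, hadd, he])⟩
  simpa using (hderiv (e.symm t)).of_local_left_inverse e.symm.continuous.continuousAt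
    (inv_ne_zero (hpos _).ne') (Eventually.of_forall he)

/-- Near `t` the sign of `v` is constant, so `v` is `√(v²)` or `-√(v²)` there. -/
lemma hasDerivAt_of_hasDerivAt_sq {v : ℝ → ℝ} {t w : ℝ} (hv : ContinuousAt v t) (h0 : v t ≠ 0)
    (h : HasDerivAt (fun s => v s ^ 2) (2 * v t * w) t) : HasDerivAt v w t := by
  have hs := h.sqrt (pow_ne_zero 2 h0)
  rcases lt_or_gt_of_ne h0 with hneg | hpos
  · have h1 : HasDerivAt (fun s => -√(v s ^ 2)) w t := by
      refine hs.neg.congr_deriv ?_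
      rw [sqrt_sq_eq_abs, abs_of_neg hneg]
      field_simp
    refine h1.congr_of_eventuallyEq ?_
    filter_upwards [hv.eventually (gt_mem_nhds hneg)] with s hs
    rw [sqrt_sq_eq_abs, abs_of_neg hs, neg_neg]
  · have h1 : HasDerivAt (fun s => √(v s ^ 2)) w t := by
      refine hs.congr_deriv ?_
      rw [sqrt_sq_eq_abs, abs_of_pos hpos]
      field_simp
    refine h1.congr_of_eventuallyEq ?_
    filter_upwards [hv.eventually (lt_mem_nhds hpos)] with s hs
    rw [sqrt_sq_eq_abs, abs_of_pos hs]

/-- The drop of an even potential below its value at `A` is `1 - s ^ 2` times a positive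
continuous function of `s = x / A`. -/
lemma exists_pos_factor {W : ℝ → ℝ} (hW : Differentiable ℝ W) (heven : W.Even)
    (hmono : StrictMonoOn W (Ici 0)) {A : ℝ} (hA : 0 < A) (hdA : 0 < deriv W A) :
    ∃ K : ℝ → ℝ, Continuous K ∧ (∀ s, 0 < K s) ∧ ∀ s, W A - W (A * s) = (1 - s ^ 2) * K s := by
  -- Comes from `1 - |s| = (1 - s²) / (1 + |s|)`; at `|s| = 1` the slope takes the value `deriv W
  -- A`.
  refine ⟨fun s => dslope W A (A * |s|) * A / (1 + |s|), ?_, fun s => ?_, fun s => ?_⟩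
  · have hd : Continuous (dslope W A) := continuousOn_univ.1
      ((continuousOn_dslope univ_mem).2 ⟨hW.continuous.continuousOn, hW A⟩)
    exact ((hd.comp (by fun_prop)).mul continuous_const).div (by fun_prop) fun s => by positivity
  · have hs : 0 < dslope W A (A * |s|) := by
      rcases eq_or_ne (A * |s|) A with h | h
      · rwa [h, dslope_same]
      · rw [dslope_of_ne _ h]
        exact hmono.slope_pos hA.le (mem_Ici.2 (by positivity)) h.symm
    positivity
  · have h1 := sub_smul_dslope W A (A * |s|)
    have h2 : W (A * |s|) = W (A * s) := by
      rcases abs_choice s with h | h <;> rw [h]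
      rw [mul_neg, heven]
    have h3 : (1 + |s|) ≠ 0 := by positivity
    rw [h2, smul_eq_mul] at h1
    rw [← sq_abs s]
    field_simp
    linear_combination (1 + |s|) * h1

/-- One-dimensional oscillation in a symmetric potential well. -/
lemma exists_periodic_oscillation {W : ℝ → ℝ} (hW : ContDiff ℝ 1 W) (heven : W.Even)
    (hmono : StrictMonoOn W (Ici 0)) {A : ℝ} (hA : 0 < A) (hdA : 0 < deriv W A) :
    ∃ (u v : ℝ → ℝ) (T : ℝ), 0 < T ∧ Function.Periodic u T ∧ v 0 ≠ 0 ∧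
      (∀ t, HasDerivAt u (v t) t) ∧ (∀ t, HasDerivAt v (-deriv W (u t)) t) ∧
      ∀ t, (1 / 2 : ℝ) * v t ^ 2 + W (u t) = W A := by
  have hWd : Differentiable ℝ W := hW.differentiable one_ne_zero
  have hW' : Continuous (deriv W) := hW.continuous_deriv le_rfl
  obtain ⟨K, hK, hKpos, hKW⟩ := exists_pos_factor hWd heven hmono hA hdA
  obtain ⟨φ, T, hT, hφ0, hφ, hφT⟩ := exists_integralCurve_of_periodic_pos
    (F := fun x => √(2 * K (sin x)) / A) (by fun_prop)
    (fun x => div_pos (sqrt_pos.2 (mul_pos two_pos (hKpos _))) hA) two_pi_pos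
    (fun x => by simp only [sin_add_two_pi])
  have hφc : Continuous φ := continuous_iff_continuousAt.2 fun t => (hφ t).continuousAt
  have hφmono : StrictMono φ := strictMono_of_deriv_pos fun t => by
    rw [(hφ t).deriv]
    exact div_pos (sqrt_pos.2 (mul_pos two_pos (hKpos _))) hA
  set u : ℝ → ℝ := fun t => A * sin (φ t) with hu
  set v : ℝ → ℝ := fun t => cos (φ t) * √(2 * K (sin (φ t))) with hv
  have hvc : Continuous v := by fun_prop
  have huc : Continuous u := by fun_prop
  have hKne : ∀ s, √(2 * K s) ≠ 0 := fun s => (sqrt_pos.2 (mul_pos two_pos (hKpos s))).ne'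
  have hu' : ∀ t, HasDerivAt u (v t) t := fun t => by
    refine ((hφ t).sin.const_mul A).congr_deriv ?_
    simp only [hv]
    field_simp
  have hen : ∀ t, (1 / 2 : ℝ) * v t ^ 2 + W (u t) = W A := fun t => by
    have h1 := hKW (sin (φ t))
    simp only [hv, hu]
    rw [mul_pow, sq_sqrt (mul_pos two_pos (hKpos _)).le, cos_sq']
    linarith
  -- `K` is only continuous, so `v` is not differentiated through its formula but through `v² = 2 (W
  -- A - W u)`.
  have hv'ne : ∀ t, v t ≠ 0 → HasDerivAt v (-deriv W (u t)) t := fun t ht => by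
    refine hasDerivAt_of_hasDerivAt_sq hvc.continuousAt ht ?_
    have h1 : (fun s => v s ^ 2) = fun s => 2 * (W A - W (u s)) := by
      funext s; linarith [hen s]
    rw [h1]
    refine ((((hWd (u t)).hasDerivAt.comp t (hu' t)).const_sub (W A)).const_mul 2).congr_deriv ?_
    ring
  have hcount : {t | v t = 0}.Countable := by
    have h1 : {t | v t = 0} ⊆ φ ⁻¹' {x | cos x = 0} := fun t ht =>
      (mul_eq_zero.1 ht).resolve_right (hKne _)
    have h2 : {x : ℝ | cos x = 0} ⊆ range fun k : ℤ => (2 * (k : ℝ) + 1) * π / 2 := fun x hx => by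
      obtain ⟨k, hk⟩ := cos_eq_zero_iff.1 hx
      exact ⟨k, hk.symm⟩
    exact (((countable_range _).mono h2).preimage hφmono.injective).mono h1
  have hW'u : Continuous fun t => -deriv W (u t) := by fun_prop
  refine ⟨u, v, T, hT, fun t => ?_, ?_, hu', fun t => ?_, hen⟩
  · simp only [hu, hφT, sin_add_two_pi]
  · simpa [hv, hφ0] using hKne 0
  -- The turning points are countable and `v` is continuous, so `v` is the integral of the
  -- continuous function `-W'(u)`, hence differentiable at the turning points too.
  · have h1 : v = fun t => v 0 + ∫ s in (0 : ℝ)..t, -deriv W (u s) := by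
      funext t
      rw [integral_eq_of_hasDerivAt_off_countable v _ hcount hvc.continuousOn
        (fun x hx => hv'ne x hx.2) (hW'u.intervalIntegrable _ _)]
      ring
    rw [h1]
    exact (intervalIntegral.integral_hasDerivAt_right (hW'u.intervalIntegrable _ _)
      (hW'u.stronglyMeasurableAtFilter _ _) hW'u.continuousAt).const_add _

lemma Function.Even.deriv_neg_eq {W : ℝ → ℝ} (heven : W.Even) (x : ℝ) :
    deriv W (-x) = -deriv W x := by
  have h := deriv_comp_neg W x
  rw [show (fun y => W (-y)) = W from funext heven] at h
  linarith

/-- The gradient of the radial function with even profile `W`, along a line through the origin. -/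
lemma hasGradientAt_radial {E : Type*} [NormedAddCommGroup E] [InnerProductSpace ℝ E]
    [CompleteSpace E] {W : ℝ → ℝ} (hW : Differentiable ℝ W) (heven : W.Even)
    {e : E} (he : ‖e‖ = 1) (r : ℝ) :
    HasGradientAt (fun x : E => W ‖x‖) (deriv W r • e) (r • e) := by
  rw [hasGradientAt_iff_hasFDerivAt]
  rcases eq_or_ne r 0 with rfl | hr
  -- The norm is not differentiable at the origin, but evenness gives `W' 0 = 0`, so `W ‖x‖ - W 0 =
  -- o(‖x‖)`.
  · have h0 : deriv W 0 = 0 := by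
      have := heven.deriv_neg_eq 0
      rw [neg_zero] at this
      linarith
    have h1 := (hW 0).hasDerivAt
    rw [h0, hasDerivAt_iff_isLittleO_nhds_zero] at h1
    simp only [zero_add, smul_zero, sub_zero] at h1
    rw [h0, zero_smul, map_zero, hasFDerivAt_iff_isLittleO_nhds_zero]
    simpa [Function.comp_def] using (h1.comp_tendsto (tendsto_norm_zero (E := E))).of_norm_right
  · have hne : r • e ≠ 0 := smul_ne_zero hr (norm_ne_zero_iff.1 (by simp [he]))
    have hsq := (hasStrictFDerivAt_norm_sq (r • e)).hasFDerivAt.sqrt (by simpa using hne)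
    simp only [sqrt_sq (norm_nonneg _)] at hsq
    have h1 := (hW ‖r • e‖).hasDerivAt.comp_hasFDerivAt _ hsq
    refine h1.congr_fderiv ?_
    ext y
    have hn : ‖r • e‖ = |r| := by rw [norm_smul, he, mul_one, norm_eq_abs]
    simp only [hn]
    rcases abs_choice r with h | h <;> rw [h]
    · simp
      field_simp
      simp
    · rw [heven.deriv_neg_eq]
      simp
      field_simp
      simp

/-- The profile of `expPotential` on a line through the origin. -/
noncomputable def expProfile (n : ℕ) (a r : ℝ) : ℝ :=
  a * r ^ (2 * n) + (expNegInvGlue r + expNegInvGlue (-r))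

/-- For `r ≥ 0` the mirrored glue term vanishes; it is there to make the profile even, and each glue
term is smooth across `0`. -/
lemma expPotential_eq {d n : ℕ} (hn : n ≠ 0) (a : ℝ) :
    expPotential d n a = fun x => expProfile n a ‖x‖ := by
  funext x
  rcases eq_or_ne x 0 with rfl | hx
  · simp [expPotential, expProfile, hn]
  · have : 0 < ‖x‖ := norm_pos_iff.2 hx
    simp [expPotential, expProfile, hx, expNegInvGlue, neg_div]

lemma contDiff_expProfile (n : ℕ) (a : ℝ) : ContDiff ℝ 1 (expProfile n a) := by
  have h : ContDiff ℝ 1 expNegInvGlue := expNegInvGlue.contDiff (n := 1)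
  have h2 : ContDiff ℝ 1 fun r => expNegInvGlue (-r) := h.comp contDiff_neg
  exact (contDiff_const.mul (contDiff_id.pow _)).add (h.add h2)

lemma even_expProfile (n : ℕ) (a : ℝ) : (expProfile n a).Even := fun r => by
  simp only [expProfile, (even_two_mul n).neg_pow, neg_neg]
  ring

lemma strictMonoOn_expProfile {n : ℕ} (hn : n ≠ 0) {a : ℝ} (ha : 0 < a) :
    StrictMonoOn (expProfile n a) (Ici 0) := fun r hr s hs hrs => by
  have h1 : r ^ (2 * n) < s ^ (2 * n) := pow_lt_pow_left₀ hrs hr (by simpa using hn)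
  have h2 := expNegInvGlue.monotone hrs.le
  have h3 := mul_lt_mul_of_pos_left h1 ha
  simp only [expProfile, expNegInvGlue.zero_of_nonpos (neg_nonpos.2 (mem_Ici.1 hr)),
    expNegInvGlue.zero_of_nonpos (neg_nonpos.2 (mem_Ici.1 hs))]
  linarith

lemma deriv_expProfile_pos {n : ℕ} (hn : n ≠ 0) {a : ℝ} (ha : 0 < a) {r : ℝ} (hr : 0 < r) :
    0 < deriv (expProfile n a) r := by
  have hd : HasDerivAt expNegInvGlue (deriv expNegInvGlue r) r :=
    (((expNegInvGlue.contDiff (n := 1)).differentiable (by simp)) r).hasDerivAt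
  have h1 := ((hasDerivAt_pow (2 * n) r).const_mul a).add hd
  have h2 : HasDerivAt (expProfile n a)
      (a * (↑(2 * n) * r ^ (2 * n - 1)) + deriv expNegInvGlue r) r := by
    refine h1.congr_of_eventuallyEq ?_
    filter_upwards [lt_mem_nhds hr] with s hs
    simp [expProfile, expNegInvGlue.zero_of_nonpos (neg_nonpos.2 hs.le)]
  have h3 : 0 ≤ deriv expNegInvGlue r := expNegInvGlue.monotone.deriv_nonneg
  rw [h2.deriv]
  have : 0 < n := Nat.pos_of_ne_zero hn
  positivity

lemma exists_expProfile_eq {n : ℕ} (hn : n ≠ 0) {a : ℝ} (ha : 0 < a) {h : ℝ} (hh : 0 < h) :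
    ∃ A, 0 < A ∧ expProfile n a A = h := by
  have h0 : expProfile n a 0 = 0 := by simp [expProfile, hn]
  -- `R ≥ 1` gives `R ^ (2 * n) ≥ R`, and `R ≥ h / a` gives `a * R ≥ h`.
  set R := max 1 (h / a) with hR
  have hR1 : 1 ≤ R := le_max_left _ _
  have h1 : h ≤ expProfile n a R := by
    have h2 : R ≤ R ^ (2 * n) := le_self_pow₀ hR1 (by simpa using hn)
    have h3 : h ≤ a * R := (div_le_iff₀' ha).1 (le_max_right _ _)
    have h4 := mul_le_mul_of_nonneg_left h2 ha.le
    have h5 := expNegInvGlue.nonneg R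
    have h6 := expNegInvGlue.nonneg (-R)
    simp only [expProfile]
    linarith
  obtain ⟨A, hA, hAh⟩ := intermediate_value_Icc (zero_le_one.trans hR1)
    (contDiff_expProfile n a).continuous.continuousOn (mem_Icc.2 ⟨h0.trans_le hh.le, h1⟩)
  refine ⟨A, lt_of_le_of_ne hA.1 fun hA0 => ?_, hAh⟩
  rw [← hA0, h0] at hAh
  exact hh.ne hAh

theorem corollary1p6 (d : ℕ) (hd : 1 ≤ d) (a : ℝ) (ha : 0 < a) (n : ℕ) (hn : 1 ≤ n)
    (h : ℝ) (hh : 1 < h) :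
    ∃ q : ℝ → EuclideanSpace ℝ (Fin d),
      IsEnergySolution (expPotential d n a) h q ∧
      (∃ T : ℝ, 0 < T ∧ Function.Periodic q T) ∧
      (∃ s t : ℝ, q s ≠ q t) := by
  have hn0 : n ≠ 0 := Nat.one_le_iff_ne_zero.1 hn
  obtain ⟨A, hA, hAh⟩ := exists_expProfile_eq hn0 ha (zero_lt_one.trans hh)
  have hW := contDiff_expProfile n a
  have heven := even_expProfile n a
  obtain ⟨u, v, T, hT, huT, hv0, hu, hv, hen⟩ := exists_periodic_oscillation hW heven
    (strictMonoOn_expProfile hn0 ha) hA (deriv_expProfile_pos hn0 ha hA)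
  set e : EuclideanSpace ℝ (Fin d) := EuclideanSpace.single ⟨0, hd⟩ 1
  have he : ‖e‖ = 1 := by simp [e]
  have hq : ∀ t, HasDerivAt (fun t => u t • e) (v t • e) t := fun t => (hu t).smul_const e
  have hq' : ∀ t, HasDerivAt (fun t => v t • e) (-deriv (expProfile n a) (u t) • e) t :=
    fun t => (hv t).smul_const e
  have hdq : deriv (fun t => u t • e) = fun t => v t • e := funext fun t => (hq t).deriv
  have hgrad : ∀ t, HasGradientAt (expPotential d n a)
      (deriv (expProfile n a) (u t) • e) (u t • e) := fun t => by
    rw [expPotential_eq hn0]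
    exact hasGradientAt_radial (hW.differentiable one_ne_zero) heven he (u t)
  have huc : Continuous u := continuous_iff_continuousAt.2 fun t => (hu t).continuousAt
  have hW' : Continuous (deriv (expProfile n a)) := hW.continuous_deriv le_rfl
  refine ⟨fun t => u t • e, ⟨?_, fun t => (hgrad t).differentiableAt, fun t => ?_, fun t => ?_⟩,
    ⟨T, hT, fun t => by simp only [huT t]⟩, ?_⟩
  · rw [show (2 : WithTop ℕ∞) = 1 + 1 from one_add_one_eq_two.symm, contDiff_succ_iff_deriv]
    refine ⟨fun t => (hq t).differentiableAt, by simp, ?_⟩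
    rw [hdq, contDiff_one_iff_deriv]
    refine ⟨fun t => (hq' t).differentiableAt, ?_⟩
    rw [show deriv (fun t => v t • e) = _ from funext fun t => (hq' t).deriv]
    fun_prop
  · rw [hdq, (hq' t).deriv, (hgrad t).gradient, neg_smul, neg_add_cancel]
  · rw [hdq, expPotential_eq hn0, ← hAh, ← hen t]
    simp only [norm_smul, he, mul_one, norm_eq_abs, sq_abs]
    -- The potential sees `|u t|`, the one-dimensional energy sees `u t`; evenness reconciles them.
    rcases abs_choice (u t) with h1 | h1 <;> rw [h1]
    rw [heven]
  · by_contra! hcon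
    have h1 : (fun t => u t • e) = fun _ => u 0 • e := funext fun t => hcon t 0
    have h2 := (hq 0).deriv
    rw [h1, deriv_const] at h2
    exact smul_ne_zero hv0 (norm_ne_zero_iff.1 (by simp [he])) h2.symm
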